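/- **Theorem 4 (decentralized converse).** Model. There are $K$ participating users and $N$ files $w_1,\dots,w_N$. User $k$ stores the files with index in $\mathcal U_k\subseteq\{1,\dots,N\}$, where $|\mathcal U_k|\le\mu N$ and $0<\mu<1$ is a constant. The sets $\mathcal U_1,\dots,\mathcal U_K$ are drawn independently from a common placement distribution $P$ on subsets of $\{1,\dots,N\}$. The *information loss* $\Delta(\mathcal U)$ is the fraction of the $N$ files that no participating user stores; the other files are called available. User $k$ has an input $d_k$ and needs the $T$-bit intermediate values $v_{k,n}=g_n(d_k;w_n)$ of all available files $n$, where the Map functions $g_n$ are arbitrary and $T\ge 1$. From its local values $\{v_{q,n}: 1\le q\le K,\ n\in\mathcal U_k\}$ user $k$ forms an uplink message $W_k$. The access point, which holds no file, broadcasts $X=\rho(W_1,\dots,W_K)$. A scheme (which may depend on the realized placement $\mathcal U$) accomplishes the computation if, whatever the Map functions, inputs and files, each user $k$ recovers $v_{k,n}$ for all available $n$ from $X$ and its local values. The *uplink load* is the total number of bits of $W_1,\dots,W_K$ divided by $NT$; the *downlink load* is the number of bits of $X$ divided by $NT$. For fixed $K$, consider dataset sizes $N\to\infty$ along any sequence (with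 $P$, $T$ and the schemes depending on $N$). The placement distributions $P$ *achieve information loss $\Delta$* if for every $\eta>0$ the probability that $\Delta(\mathcal U)\le\Delta+\eta$ tends to $1$. The schemes *achieve loads $L_u,L_d$ with high probability* if for every $\eta>0$, with probability tending to $1$, the scheme accomplishes the computation with uplink load at most $L_u+\eta$ and downlink load at most $L_d+\eta$. Claim. For every $\mu\in(0,1)$ and $\varepsilon>0$ there are $K_0\in\mathbb N$ and $\delta>0$, depending only on $\mu$ and $\varepsilon$, such that for all $K\ge K_0$ and all $\Delta\le\delta$: for any placement distributions $P$ that achieve information loss $\Delta$, and any communication schemes that achieve loads $L_u$ and $L_d$ with high probability, $$L_u\ \ge\ \frac1\mu-1-\varepsilon\qquad\text{and}\qquad L_d\ \ge\ \frac1\mu-1-\varepsilon .$$ That is, both loads are asymptotically lower bounded by $\frac1\mu-1$ as $K\to\infty$ and $\Delta\to0$. -/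

import Mathlib

open Filter Topology MeasureTheory

/-- Bit strings of length `n`. -/
abbrev Bits (n : ℕ) : Type := Fin n → Bool

/-- A realized dataset placement: user `k` stores exactly the files with index in `U k`. -/
abbrev Placement (K N : ℕ) : Type := Fin K → Finset (Fin N)

/-- The indices of the files stored by at least one participating user. -/
def Placement.available {K N : ℕ} (U : Placement K N) : Finset (Fin N) :=
  Finset.univ.biUnion U

/-- The information loss: the fraction of the files stored by no participating user. -/
noncomputable def Placement.infoLoss {K N : ℕ} (U : Placement K N) : ℝ :=
  ((U.availableᶜ).card : ℝ) / N

/-- The intermediate values `v k n = g n (d k) (w n)`, for Map functions `g n`, user inputs `d k`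
and files `w n`. -/
def intermediate {K N D F T : ℕ} (g : Fin N → Bits D → Bits F → Bits T)
    (d : Fin K → Bits D) (w : Fin N → Bits F) : Fin K → Fin N → Bits T :=
  fun k n => g n (d k) (w n)

/-- The intermediate values computed by user `k` in the Map phase: those of all `K` inputs in all
the files stored by `k`. -/
abbrev LocalValues {K N : ℕ} (U : Placement K N) (T : ℕ) (k : Fin K) : Type :=
  Fin K → {n : Fin N // n ∈ U k} → Bits T

/-- The local part, at user `k`, of an array of intermediate values. -/
def localPart {K N T : ℕ} (U : Placement K N) (v : Fin K → Fin N → Bits T) (k : Fin K) :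
    LocalValues U T k :=
  fun q n => v q n.1

/-- An uplink-downlink communication scheme for the placement `U` and intermediate values of `T`
bits. User `k` sends a message of `upLen k` bits, a function of its local intermediate values; the
access point, which has no file, broadcasts a message of `downLen` bits, a function of the uplink
messages; user `k` estimates its intermediate value in each available file from its local values
and the broadcast message. -/
structure ShuffleScheme {K N : ℕ} (U : Placement K N) (T : ℕ) where
  upLen : Fin K → ℕ
  downLen : ℕ
  encode : ∀ k : Fin K, LocalValues U T k → Bits (upLen k)
  relay : (∀ k : Fin K, Bits (upLen k)) → Bits downLen
  decode : ∀ k : Fin K, LocalValues U T k → Bits downLen →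
    {n : Fin N // n ∈ U.available} → Bits T

namespace ShuffleScheme

variable {K N T : ℕ} {U : Placement K N}

/-- The message broadcast on the downlink when the intermediate values are `v`. -/
def broadcast (S : ShuffleScheme U T) (v : Fin K → Fin N → Bits T) : Bits S.downLen :=
  S.relay fun k => S.encode k (localPart U v k)

/-- The scheme accomplishes the computation: whatever the Map functions, the inputs and the files,
every user `k` recovers the arguments of its Reduce function, i.e. its intermediate values `v k n`
in all the available files `n`. -/
def Correct (S : ShuffleScheme U T) : Prop :=
  ∀ (D F : ℕ) (g : Fin N → Bits D → Bits F → Bits T) (d : Fin K → Bits D) (w : Fin N → Bits F)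
    (k : Fin K) (n : {n : Fin N // n ∈ U.available}),
    S.decode k (localPart U (intermediate g d w) k) (S.broadcast (intermediate g d w)) n
      = intermediate g d w k n.1

/-- Total number of uplink bits, normalized by `N * T`. -/
noncomputable def uplinkLoad (S : ShuffleScheme U T) : ℝ :=
  ((∑ k, S.upLen k : ℕ) : ℝ) / ((N : ℝ) * T)

/-- Number of downlink bits, normalized by `N * T`. -/
noncomputable def downlinkLoad (S : ShuffleScheme U T) : ℝ :=
  (S.downLen : ℝ) / ((N : ℝ) * T)

end ShuffleScheme

/-- The law of the random placement of `K` participating users, each of which chooses its files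
independently of the others with the common placement distribution `P`. -/
noncomputable def placementLaw (K : ℕ) {N : ℕ} (P : PMF (Finset (Fin N))) :
    Measure (Placement K N) :=
  Measure.pi fun _ : Fin K => P.toMeasure

/-- `P` only chooses sets of files that fit into a memory for a fraction `μ` of the dataset. -/
def FitsStorage (μ : ℝ) {N : ℕ} (P : PMF (Finset (Fin N))) : Prop :=
  ∀ s ∈ P.support, (s.card : ℝ) ≤ μ * N

/-- For `K` users and dataset sizes `N i`, the placement distributions `P i` achieve information
loss `Δ` with high probability: up to an arbitrarily small slack, the information loss is at most
`Δ` with probability tending to `1`. -/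
def AchievesInfoLoss (K : ℕ) {N : ℕ → ℕ} (P : ∀ i, PMF (Finset (Fin (N i)))) (Δ : ℝ) : Prop :=
  ∀ η : ℝ, 0 < η →
    Tendsto (fun i => placementLaw K (P i) {U | U.infoLoss ≤ Δ + η}) atTop (𝓝 1)

/-- The schemes `S i U`, one for each dataset size `N i` and each realized placement `U`, achieve
the loads `Lu` and `Ld` with high probability: up to an arbitrarily small slack, with probability
tending to `1` the scheme accomplishes the computation with loads at most `Lu` and `Ld`. -/
def AchievesLoads {K : ℕ} {N T : ℕ → ℕ} (P : ∀ i, PMF (Finset (Fin (N i))))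
    (S : ∀ (i : ℕ) (U : Placement K (N i)), ShuffleScheme U (T i)) (Lu Ld : ℝ) : Prop :=
  ∀ η : ℝ, 0 < η →
    Tendsto (fun i => placementLaw K (P i)
      {U | (S i U).Correct ∧ (S i U).uplinkLoad ≤ Lu + η ∧ (S i U).downlinkLoad ≤ Ld + η})
      atTop (𝓝 1)

/-! Fix a placement and order the users. Let all intermediate values vanish except the acyclic
demands: pairs of a user `k` and an available file stored by no user up to `k`. The broadcast alone
then determines the array: the nonzero local values of user `k` belong to earlier users, so decoding
proceeds user by user (`injective_of_decodable`). Counting bit strings bounds both message lengths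
below by `T` times the number of acyclic demands.

For random placements, a file omitted by one user with probability `p` is missed by the first `r`
users with probability `p ^ r`. The average of `p` over the files is at least `1 - μ`, so by Jensen
the mean missing fraction is at least `(1 - μ) ^ r`. Summing over `r ≥ 1` gives `1 / μ - 1`.

Only the first `m` users are used, with `m` depending on `μ` and `ε`: unavailable files then cost at
most `m * Δ`. No concentration is needed: a bounded quantity that is at most `b` with probability
tending to `1` has limiting mean at most `b`. -/

variable {K N T : ℕ}

/-! ### Lower bound for a fixed placement -/

/-- Every array of intermediate values arises from some Map functions, inputs and files. -/
theorem exists_intermediate_eq (v : Fin K → Fin N → Bits T) :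
    ∃ (g : Fin N → Bits K → Bits 0 → Bits T) (d : Fin K → Bits K) (w : Fin N → Bits 0),
      intermediate g d w = v := by
  -- One-hot inputs are distinct, so a Map function may assign each user any value; the files need
  -- carry no bits.
  let d : Fin K → Bits K := fun k j => decide (j = k)
  have hd : Function.Injective d := by
    intro a b h
    have := congrFun h a
    simpa [d] using this
  refine ⟨fun n x _ => Function.extend d (fun k => v k n) (fun _ _ => false) x, d,
    fun _ _ => false, ?_⟩
  funext k n
  exact hd.extend_apply (fun k => v k n) (fun _ _ => false) k

theorem ShuffleScheme.Correct.decode_eq {U : Placement K N} {S : ShuffleScheme U T}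
    (hS : S.Correct) (v : Fin K → Fin N → Bits T) (k : Fin K)
    (n : {n : Fin N // n ∈ U.available}) :
    S.decode k (localPart U v k) (S.broadcast v) n = v k n.1 := by
  obtain ⟨g, d, w, rfl⟩ := exists_intermediate_eq v
  exact hS K 0 g d w k n

/-- The files stored by none of the users up to `k`. -/
def Placement.missing (U : Placement K N) (k : Fin K) : Finset (Fin N) :=
  Finset.univ.filter fun n => ∀ j ≤ k, n ∉ U j

/-- The pairs of a user `k` and an available file that no user up to `k` stores. -/
def Placement.acyclicDemands (U : Placement K N) : Finset (Fin K × Fin N) :=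
  Finset.univ.filter fun p => p.2 ∈ U.available ∧ p.2 ∈ U.missing p.1

/-- The array of intermediate values that extends `x` by zero. -/
def extendByZero (I : Finset (Fin K × Fin N)) (x : I → Bits T) : Fin K → Fin N → Bits T :=
  fun k n => if h : (k, n) ∈ I then x ⟨(k, n), h⟩ else fun _ => false

/-- Arrays supported on the acyclic demands are determined by any message from which, together
with its local values, every user can recover its demands. -/
theorem injective_of_decodable {U : Placement K N} {β : Type*}
    (m : (Fin K → Fin N → Bits T) → β)
    (dec : ∀ k : Fin K, LocalValues U T k → β → {n : Fin N // n ∈ U.available} → Bits T)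
    (h : ∀ v k n, dec k (localPart U v k) (m v) n = v k n.1) :
    Function.Injective fun x : U.acyclicDemands → Bits T => m (extendByZero _ x) := by
  intro x y hxy
  have hxy : m (extendByZero _ x) = m (extendByZero _ y) := hxy
  have key : ∀ (k : Fin K) (n : Fin N), extendByZero U.acyclicDemands x k n =
      extendByZero U.acyclicDemands y k n := by
    intro k
    induction k using WellFoundedLT.induction with
    | ind k ih =>
      have hloc : localPart U (extendByZero U.acyclicDemands x) k =
          localPart U (extendByZero U.acyclicDemands y) k := by
        funext q n
        rcases lt_or_ge q k with hq | hq
        · exact ih q hq n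
        -- For `q ≥ k`, a file stored by user `k` is not missing up to `q`, so this entry is zero in
        -- both arrays.
        · have hn : (q, n.1) ∉ U.acyclicDemands := fun hmem => by
            simp only [Placement.acyclicDemands, Placement.missing, Finset.mem_filter,
              Finset.mem_univ, true_and] at hmem
            exact hmem.2 k hq n.2
          simp [localPart, extendByZero, hn]
      intro n
      by_cases hn : (k, n) ∈ U.acyclicDemands
      · have hav : n ∈ U.available := (Finset.mem_filter.1 hn).2.1
        have hx := h (extendByZero _ x) k ⟨n, hav⟩
        rw [hloc, hxy, h] at hx
        exact hx.symm
      · simp [extendByZero, hn]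
  funext p
  simpa [extendByZero] using key p.1.1 p.1.2

theorem mul_card_acyclicDemands_le_downLen {U : Placement K N} {S : ShuffleScheme U T}
    (hS : S.Correct) : U.acyclicDemands.card * T ≤ S.downLen := by
  have := Fintype.card_le_of_injective _ (injective_of_decodable S.broadcast S.decode hS.decode_eq)
  simp only [Fintype.card_pi, Fintype.card_bool, Finset.prod_const, Finset.card_univ,
    Fintype.card_fin, Fintype.card_coe, ← pow_mul] at this
  rw [mul_comm]
  exact (Nat.pow_le_pow_iff_right one_lt_two).1 this

/-- The uplink messages determine the broadcast, so jointly they too are decodable by every user. -/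
theorem mul_card_acyclicDemands_le_upLen {U : Placement K N} {S : ShuffleScheme U T}
    (hS : S.Correct) : U.acyclicDemands.card * T ≤ ∑ k, S.upLen k := by
  have := Fintype.card_le_of_injective _ (injective_of_decodable
    (fun v k => S.encode k (localPart U v k)) (fun k l W => S.decode k l (S.relay W)) hS.decode_eq)
  simp only [Fintype.card_pi, Fintype.card_bool, Finset.prod_const, Finset.card_univ,
    Fintype.card_fin, Fintype.card_coe, ← pow_mul, Finset.prod_pow_eq_pow_sum] at this
  rw [mul_comm]
  exact (Nat.pow_le_pow_iff_right one_lt_two).1 this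

/-- The number of acyclic demands of the first `m` users, when the unavailable files are counted
as well. -/
def Placement.prefixMissing (U : Placement K N) (m : ℕ) : ℕ :=
  ∑ k : Fin K with k.1 < m, (U.missing k).card

theorem card_filter_val_lt (K m : ℕ) : (Finset.univ.filter fun k : Fin K => k.1 < m).card ≤ m := by
  have := Finset.card_le_card_of_injOn (s := Finset.univ.filter fun k : Fin K => k.1 < m)
    (t := Finset.range m) Fin.val (by intro k; simp) Fin.val_injective.injOn
  simpa using this

theorem Placement.prefixMissing_le (U : Placement K N) (m : ℕ) :
    U.prefixMissing m ≤ m * N := by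
  calc U.prefixMissing m ≤ ∑ k : Fin K with k.1 < m, N :=
        Finset.sum_le_sum fun k _ => (Finset.card_le_univ _).trans (by simp)
    _ ≤ m * N := by
        rw [Finset.sum_const, smul_eq_mul]
        exact Nat.mul_le_mul_right _ (card_filter_val_lt K m)

/-- An unavailable file is counted at most once for each of the first `m` users. -/
theorem Placement.prefixMissing_le_acyclicDemands (U : Placement K N) (m : ℕ) :
    U.prefixMissing m ≤ U.acyclicDemands.card + m * U.availableᶜ.card := by
  have hcard : U.acyclicDemands.card = ∑ k, (U.available ∩ U.missing k).card := by
    rw [← Finset.card_sigma]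
    refine Finset.card_bij' (fun p _ => ⟨p.1, p.2⟩) (fun p _ => (p.1, p.2)) ?_ ?_ ?_ ?_ <;>
      simp [Placement.acyclicDemands]
  calc U.prefixMissing m
      ≤ ∑ k : Fin K with k.1 < m, ((U.available ∩ U.missing k).card + U.availableᶜ.card) := by
        refine Finset.sum_le_sum fun k _ => (Finset.card_le_card ?_).trans (Finset.card_union_le _ _)
        intro n hn
        by_cases h : n ∈ U.available <;> simp [h, hn]
    _ = ∑ k : Fin K with k.1 < m, (U.available ∩ U.missing k).card
          + (Finset.univ.filter fun k : Fin K => k.1 < m).card * U.availableᶜ.card := by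
        rw [Finset.sum_add_distrib, Finset.sum_const, smul_eq_mul]
    _ ≤ _ := by
        rw [hcard]
        exact add_le_add (Finset.sum_le_sum_of_subset (Finset.filter_subset _ _))
          (Nat.mul_le_mul_right _ (card_filter_val_lt K m))

theorem prefixMissing_div_le {U : Placement K N} (m : ℕ) {ℓ : ℕ} (hN : 0 < N) (hT : 0 < T)
    (hℓ : U.acyclicDemands.card * T ≤ ℓ) :
    (U.prefixMissing m : ℝ) / N ≤ (ℓ : ℝ) / (N * T) + m * U.infoLoss := by
  have hN' : (0 : ℝ) < N := by exact_mod_cast hN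
  have hT' : (0 : ℝ) < T := by exact_mod_cast hT
  have h1 : (U.prefixMissing m : ℝ) ≤ U.acyclicDemands.card + m * U.availableᶜ.card := by
    exact_mod_cast U.prefixMissing_le_acyclicDemands m
  have h2 : (U.acyclicDemands.card : ℝ) * T ≤ ℓ := by exact_mod_cast hℓ
  have h3 : (U.acyclicDemands.card : ℝ) / N ≤ ℓ / (N * T) := by
    rw [div_le_div_iff₀ hN' (by positivity)]
    nlinarith
  calc (U.prefixMissing m : ℝ) / N ≤ (U.acyclicDemands.card + m * U.availableᶜ.card) / N := by
        gcongr
    _ = (U.acyclicDemands.card : ℝ) / N + m * U.infoLoss := by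
        rw [Placement.infoLoss]; ring
    _ ≤ _ := by gcongr

/-! ### Mean number of missing files under a random placement -/

instance (P : PMF (Finset (Fin N))) : IsProbabilityMeasure (placementLaw K P) := by
  unfold placementLaw; infer_instance

theorem placementLaw_real_forall_notMem (P : PMF (Finset (Fin N))) (k : Fin K) (n : Fin N) :
    (placementLaw K P).real {U | ∀ j ≤ k, n ∉ U j} =
      (P.toMeasure.real {s | n ∉ s}) ^ (k.1 + 1) := by
  -- The event is a box, so its product measure factors over the users.
  have hset : {U : Placement K N | ∀ j ≤ k, n ∉ U j} =
      Set.univ.pi fun j : Fin K => if j ≤ k then {s : Finset (Fin N) | n ∉ s} else Set.univ := by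
    ext U
    simp only [Set.mem_ofPred_eq, Set.mem_pi, Set.mem_univ, true_imp_iff]
    refine forall_congr' fun j => ?_
    by_cases h : j ≤ k <;> simp [h]
  have hcard : (Finset.univ.filter fun j : Fin K => j ≤ k).card = k.1 + 1 := by
    rw [← Fin.card_Iic k]; congr 1; ext; simp
  rw [hset, measureReal_def, placementLaw, Measure.pi_pi, ENNReal.toReal_prod, ← hcard,
    ← Finset.prod_const, Finset.prod_filter]
  refine Finset.prod_congr rfl fun j _ => ?_
  by_cases h : j ≤ k <;> simp [h, measureReal_def]

/-- By linearity, the sum is the mean number of files that one user omits, and every set in the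
support omits at least `(1 - μ) * N`. -/
theorem sum_real_notMem_ge {μ : ℝ} {P : PMF (Finset (Fin N))} (hP : FitsStorage μ P) :
    (1 - μ) * N ≤ ∑ n, P.toMeasure.real {s | n ∉ s} := by
  have h1 : ∑ n, P.toMeasure.real {s | n ∉ s} =
      ∫ s, ∑ n : Fin N, Set.indicator {s : Finset (Fin N) | n ∉ s} (fun _ => (1 : ℝ)) s
        ∂P.toMeasure := by
    rw [integral_finsetSum _ fun _ _ => .of_finite]
    refine Finset.sum_congr rfl fun n _ => ?_
    rw [integral_indicator_const _ (Set.toFinite _).measurableSet]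
    simp
  have h2 : ∀ᵐ s ∂P.toMeasure, (1 - μ) * N ≤
      ∑ n : Fin N, Set.indicator {s : Finset (Fin N) | n ∉ s} (fun _ => (1 : ℝ)) s := by
    rw [ae_iff, PMF.toMeasure_apply_eq_zero_iff _ (Set.toFinite _).measurableSet,
      Set.disjoint_right]
    intro s hs hsupp
    refine hs ?_
    have h3 : ∑ n : Fin N, Set.indicator {s : Finset (Fin N) | n ∉ s} (fun _ => (1 : ℝ)) s =
        (sᶜ.card : ℝ) := by
      have hcompl : sᶜ = Finset.univ.filter fun n => n ∉ s := by ext; simp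
      rw [hcompl, Finset.card_filter, Nat.cast_sum]
      exact Finset.sum_congr rfl fun n _ => by simp [Set.indicator_apply]
    rw [h3, Finset.card_compl, Nat.cast_sub (Finset.card_le_univ _), Fintype.card_fin]
    have := hP s hsupp
    linarith
  rw [h1]
  calc (1 - μ) * N = ∫ _, (1 - μ) * N ∂P.toMeasure := by simp
    _ ≤ _ := integral_mono_ae (integrable_const _) .of_finite h2

/-- Convexity of the power: uneven popularity of the files only increases the sum. -/
theorem sum_pow_real_notMem_ge {μ : ℝ} (hμ : μ ≤ 1) {P : PMF (Finset (Fin N))}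
    (hP : FitsStorage μ P) (hN : 0 < N) (r : ℕ) :
    (1 - μ) ^ r * N ≤ ∑ n, (P.toMeasure.real {s | n ∉ s}) ^ r := by
  have hN' : (0 : ℝ) < N := by exact_mod_cast hN
  have hJ := Real.pow_arith_mean_le_arith_mean_pow (Finset.univ : Finset (Fin N))
    (fun _ => (1 : ℝ) / N) (fun n => P.toMeasure.real {s | n ∉ s}) (fun _ _ => by positivity)
    (by simp [hN'.ne']) (fun _ _ => measureReal_nonneg) r
  simp only [← Finset.mul_sum] at hJ
  have h1 : 1 - μ ≤ 1 / N * ∑ n, P.toMeasure.real {s | n ∉ s} := by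
    rw [one_div, inv_mul_eq_div, le_div_iff₀ hN']
    exact sum_real_notMem_ge hP
  have h2 := (pow_le_pow_left₀ (sub_nonneg.2 hμ) h1 r).trans hJ
  rwa [one_div, inv_mul_eq_div, le_div_iff₀ hN'] at h2

theorem integral_prefixMissing_ge {μ : ℝ} (hμ : μ ≤ 1) {P : PMF (Finset (Fin N))}
    (hP : FitsStorage μ P) (hN : 0 < N) {m : ℕ} (hm : m ≤ K) :
    ∑ r ∈ Finset.range m, (1 - μ) ^ (r + 1) ≤
      ∫ U : Placement K N, (U.prefixMissing m : ℝ) / N ∂placementLaw K P := by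
  have hN' : (0 : ℝ) < N := by exact_mod_cast hN
  have hmiss : ∀ k : Fin K, ∫ U : Placement K N, ((U.missing k).card : ℝ) ∂placementLaw K P =
      ∑ n, (P.toMeasure.real {s | n ∉ s}) ^ (k.1 + 1) := by
    intro k
    have h : ∀ U : Placement K N, ((U.missing k).card : ℝ) =
        ∑ n, Set.indicator {U : Placement K N | ∀ j ≤ k, n ∉ U j} (fun _ => (1 : ℝ)) U := by
      intro U
      simp [Placement.missing, Set.indicator_apply]
    simp only [h]
    rw [integral_finsetSum _ fun _ _ => .of_finite]
    refine Finset.sum_congr rfl fun n _ => ?_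
    rw [integral_indicator_const _ (Set.toFinite _).measurableSet,
      placementLaw_real_forall_notMem]
    simp
  have hsum : ∑ r ∈ Finset.range m, (1 - μ) ^ (r + 1) =
      ∑ k : Fin K with k.1 < m, (1 - μ) ^ (k.1 + 1) := by
    symm
    refine Finset.sum_bij (fun k _ => k.1) (by simp) (fun _ _ _ _ h => Fin.ext h) ?_ (by simp)
    intro r hr
    have hr := Finset.mem_range.1 hr
    exact ⟨⟨r, hr.trans_le hm⟩, by simpa using hr, rfl⟩
  rw [integral_div, le_div_iff₀ hN', hsum]
  simp only [Placement.prefixMissing, Nat.cast_sum]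
  rw [integral_finsetSum _ fun _ _ => .of_finite, Finset.sum_mul]
  refine Finset.sum_le_sum fun k _ => ?_
  rw [hmiss]
  exact sum_pow_real_notMem_ge hμ hP hN _

/-! ### From means to loads achieved with high probability -/

/-- If a function bounded by `C` is at most `b` on `A ∩ B`, then its mean exceeds `b` at most by
`C + |b|` times the sum of the probabilities of the complements of `A` and `B`. -/
theorem integral_le_add_mul_compl {Ω : Type*} [MeasurableSpace Ω] [Finite Ω]
    [MeasurableSingletonClass Ω] (Q : Measure Ω) [IsProbabilityMeasure Q] {f : Ω → ℝ} {b C : ℝ}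
    {A B : Set Ω} (hC : ∀ x, f x ≤ C) (hC0 : 0 ≤ C) (hb : ∀ x ∈ A, x ∈ B → f x ≤ b) :
    ∫ x, f x ∂Q ≤ b + (C + |b|) * ((1 - Q.real A) + (1 - Q.real B)) := by
  have hA : MeasurableSet A := (Set.toFinite _).measurableSet
  have hB : MeasurableSet B := (Set.toFinite _).measurableSet
  have hD : 0 ≤ C + |b| := by positivity
  calc ∫ x, f x ∂Q
      ≤ ∫ x, (b + (Aᶜ.indicator (fun _ => C + |b|) x + Bᶜ.indicator (fun _ => C + |b|) x)) ∂Q := by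
        refine integral_mono .of_finite .of_finite fun x => ?_
        have h0 := hC x
        have h1 := neg_abs_le b
        by_cases hxA : x ∈ A <;> by_cases hxB : x ∈ B <;> simp [hxA, hxB]
        · exact hb x hxA hxB
        all_goals linarith
    _ = _ := by
        rw [integral_add .of_finite .of_finite, integral_add .of_finite .of_finite,
          integral_indicator_const _ hA.compl, integral_indicator_const _ hB.compl,
          probReal_compl_eq_one_sub hA, probReal_compl_eq_one_sub hB]
        simp only [integral_const, probReal_univ, smul_eq_mul]
        ring

/-- The common converse for a communication load that is at least the normalized number of
acyclic demands. -/
theorem sum_pow_le_load {μ : ℝ} (hμ : μ ≤ 1) {m : ℕ} (hm : m ≤ K) {Δ L : ℝ} {N : ℕ → ℕ}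
    (hN : Tendsto N atTop atTop) {P : ∀ i, PMF (Finset (Fin (N i)))}
    (hP : ∀ i, FitsStorage μ (P i)) (hΔ : AchievesInfoLoss K P Δ)
    (G : ℝ → ∀ i, Set (Placement K (N i)))
    (hG : ∀ η, 0 < η → Tendsto (fun i => placementLaw K (P i) (G η i)) atTop (𝓝 1))
    (hL : ∀ η i, 0 < N i → ∀ U ∈ G η i,
      (U.prefixMissing m : ℝ) / N i ≤ L + η + m * U.infoLoss) :
    ∑ r ∈ Finset.range m, (1 - μ) ^ (r + 1) ≤ L + m * Δ := by
  have key : ∀ η : ℝ, 0 < η →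
      ∑ r ∈ Finset.range m, (1 - μ) ^ (r + 1) ≤ L + η + m * (Δ + η) := by
    intro η hη
    have toReal_tendsto : ∀ {u : ℕ → ENNReal}, Tendsto u atTop (𝓝 1) →
        Tendsto (fun i => (u i).toReal) atTop (𝓝 1) := fun h => by
      exact (ENNReal.tendsto_toReal ENNReal.one_ne_top).comp h
    have hA := toReal_tendsto (hG η hη)
    have hB := toReal_tendsto (hΔ η hη)
    have hlim : Tendsto (fun i => (L + η + m * (Δ + η)) + (m + |L + η + m * (Δ + η)|) *
        ((1 - (placementLaw K (P i)).real (G η i)) +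
          (1 - (placementLaw K (P i)).real {U | U.infoLoss ≤ Δ + η}))) atTop
        (𝓝 ((L + η + m * (Δ + η)) + (m + |L + η + m * (Δ + η)|) * ((1 - 1) + (1 - 1)))) :=
      (((hA.const_sub 1).add (hB.const_sub 1)).const_mul _).const_add _
    have hfin : ∑ r ∈ Finset.range m, (1 - μ) ^ (r + 1) ≤
        (L + η + m * (Δ + η)) + (m + |L + η + m * (Δ + η)|) * ((1 - 1) + (1 - 1)) := by
      refine ge_of_tendsto hlim ?_
      filter_upwards [hN.eventually_gt_atTop 0] with i hi
      refine (integral_prefixMissing_ge hμ (hP i) hi hm).trans ?_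
      refine integral_le_add_mul_compl _ (fun U => ?_) (by positivity) (fun U hUG hUI => ?_)
      · rw [div_le_iff₀ (by exact_mod_cast hi)]
        exact_mod_cast U.prefixMissing_le m
      · refine (hL η i hi U hUG).trans ?_
        have hUI : U.infoLoss ≤ Δ + η := hUI
        gcongr
    simpa using hfin
  refine le_of_forall_pos_le_add fun η hη => ?_
  -- With this slack, the load and the `m` copies of the loss contribute exactly `η` together.
  have h := key (η / (m + 1)) (by positivity)
  have : η / (m + 1) + m * (η / (m + 1)) = η := by field_simp; ring
  linarith

/-- Partial sums of the geometric series approach `1 / μ - 1`. -/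
theorem exists_sum_pow_ge {μ : ℝ} (hμ0 : 0 < μ) (hμ1 : μ < 1) {ε : ℝ} (hε : 0 < ε) :
    ∃ m : ℕ, 1 / μ - 1 - ε ≤ ∑ r ∈ Finset.range m, (1 - μ) ^ (r + 1) := by
  have h := ((hasSum_geometric_of_lt_one (by linarith : 0 ≤ 1 - μ) (by linarith)).mul_right
    (1 - μ)).tendsto_sum_nat
  have hval : (1 - (1 - μ))⁻¹ * (1 - μ) = 1 / μ - 1 := by
    rw [sub_sub_cancel]; field_simp
  rw [hval] at h
  obtain ⟨m, hm⟩ := (h.eventually_const_le (by linarith : 1 / μ - 1 - ε < 1 / μ - 1)).exists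
  exact ⟨m, by simpa only [pow_succ] using hm⟩

theorem theorem4 (μ : ℝ) (hμ0 : 0 < μ) (hμ1 : μ < 1) (ε : ℝ) (hε : 0 < ε) :
    ∃ K₀ : ℕ, ∃ δ : ℝ, 0 < δ ∧
      ∀ (K : ℕ), K₀ ≤ K → ∀ (Δ : ℝ), Δ ≤ δ →
      ∀ (N T : ℕ → ℕ), Tendsto N atTop atTop → (∀ i, 1 ≤ T i) →
      ∀ (P : ∀ i, PMF (Finset (Fin (N i)))), (∀ i, FitsStorage μ (P i)) →
        AchievesInfoLoss K P Δ →
      ∀ (S : ∀ (i : ℕ) (U : Placement K (N i)), ShuffleScheme U (T i)) (Lu Ld : ℝ),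
        AchievesLoads P S Lu Ld →
        1 / μ - 1 - ε ≤ Lu ∧ 1 / μ - 1 - ε ≤ Ld := by
  obtain ⟨m, hm⟩ := exists_sum_pow_ge hμ0 hμ1 (half_pos hε)
  -- Half of `ε` pays for truncating the series, half for `m * Δ`; `m + 1` keeps the denominator
  -- nonzero when `m = 0`.
  refine ⟨m, ε / (2 * (m + 1)), by positivity, ?_⟩
  intro K hK Δ hΔ N T hN hT P hP hI S Lu Ld hS
  have hmΔ : m * Δ ≤ ε / 2 := by
    calc m * Δ ≤ (m + 1) * (ε / (2 * (m + 1))) := by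
          have h1 : m * Δ ≤ m * (ε / (2 * (m + 1))) := by gcongr
          have h2 : 0 ≤ ε / (2 * ((m : ℝ) + 1)) := by positivity
          linarith
      _ = ε / 2 := by field_simp
  have hu := sum_pow_le_load hμ1.le hK hN hP hI _ (L := Lu) hS fun η i hi U hU =>
    (prefixMissing_div_le m hi (hT i) (mul_card_acyclicDemands_le_upLen hU.1)).trans
      (add_le_add_left hU.2.1 _)
  have hd := sum_pow_le_load hμ1.le hK hN hP hI _ (L := Ld) hS fun η i hi U hU =>
    (prefixMissing_div_le m hi (hT i) (mul_card_acyclicDemands_le_downLen hU.1)).trans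
      (add_le_add_left hU.2.2 _)
  exact ⟨by linarith, by linarith⟩
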